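/- Let $\Sigma$ be a finite alphabet with $k\ge 2$ symbols, and let $\log$ denote the base-2 logarithm. A finite-state compressor $C$ on an alphabet $\Gamma$ consists of a nonempty finite state set $Q$, an initial state $q_0$, a transition function $\delta:Q\times\Gamma\to Q$ and an output function $\nu:Q\times\Gamma\to\{0,1\}^*$. For $u\in\Gamma^*$, let $\delta^*(u)$ be the state reached from $q_0$ after reading $u$, and let $C(u)\in\{0,1\}^*$ be the concatenation of the outputs produced along the way. $C$ is information-lossless if $u\mapsto(C(u),\delta^*(u))$ is injective on $\Gamma^*$. For $r\ge1$, $n\ge 1$ and $u,w\in\Sigma^n$, let $$\rho_r(u)=\min_C\frac{|C(u)|}{n\log k},\qquad \rho_r(u,w)=\min_{C'}\frac{|C'((u,w))|}{n\log k},$$ where $C$ and $C'$ range over the information-lossless finite-state compressors with exactly $r$ states on $\Sigma$ and on $\Sigma\times\Sigma$, respectively, and $(u,w)\in(\Sigma\times\Sigma)^n$ is the string of pairs of symbols. For sequences $S,T\in\Sigma^\infty$, with $S\upharpoonright n$ denoting the first $n$ symbols of $S$, and $r,t\ge1$, let $\rho_{r,t}(S:T)$ and $\hat\rho_{r,t}(S:T)$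 be the $\liminf$ and the $\limsup$, as $n\to\infty$, of $$\rho_t(S\upharpoonright n)+\rho_t(T\upharpoonright n)-\rho_r(S\upharpoonright n,T\upharpoonright n),$$ and define the lower and upper finite-state mutual dimensions $$mdim_{FS}(S:T)=\lim_{r\to\infty}\lim_{t\to\infty}\rho_{r,t}(S:T),\qquad Mdim_{FS}(S:T)=\lim_{r\to\infty}\lim_{t\to\infty}\hat\rho_{r,t}(S:T).$$ For a probability measure $\alpha$ on a finite alphabet $\Gamma$, a sequence $R\in\Gamma^\infty$ is $\alpha$-normal if for every $\ell\ge1$ and every $x=x_1\cdots x_\ell\in\Gamma^\ell$, the fraction of the first $n$ aligned (consecutive, disjoint) length-$\ell$ blocks of $R$ that are equal to $x$ tends to $\prod_{i=1}^{\ell}\alpha(x_i)$ as $n\to\infty$. For a probability measure $\alpha$ on $\Sigma\times\Sigma$ with marginals $\alpha_1,\alpha_2$, let $I(\alpha_1;\alpha_2)=H(\alpha_1)+H(\alpha_2)-H(\alpha)$, where $H(\beta)=\sum_x\beta(x)\log\frac1{\beta(x)}$ is the Shannon entropy (with $0\log\frac10=0$). **Theorem.** If $\alpha$ is a probability measure on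 $\Sigma\times\Sigma$ then, for all $R_1,R_2\in\Sigma^\infty$ such that the sequence of pairs $(R_1,R_2)\in(\Sigma\times\Sigma)^\infty$ is $\alpha$-normal, the iterated limits defining $mdim_{FS}(R_1:R_2)$ and $Mdim_{FS}(R_1:R_2)$ exist and $$mdim_{FS}(R_1:R_2)=Mdim_{FS}(R_1:R_2)=\frac{I(\alpha_1;\alpha_2)}{\log k}.$$ -/

import Mathlib

open Filter Topology

namespace FSMutual

/-! ### Finite-state compressors -/

/-- A finite-state compressor on the input alphabet `A` with state set `Q`
(finiteness of `Q` is imposed where compressors are used). -/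
structure FSC (A : Type*) (Q : Type*) where
  /-- transition function -/
  trans : Q → A → Q
  /-- output function -/
  out : Q → A → List Bool
  /-- initial state -/
  init : Q

namespace FSC

variable {A Q : Type*}

/-- Extended transition function. -/
def transStar (C : FSC A Q) (q : Q) (u : List A) : Q := u.foldl C.trans q

/-- The concatenated output when reading `u` from the state `q`. -/
def outStar (C : FSC A Q) : Q → List A → List Bool
  | _, [] => []
  | q, a :: u => C.out q a ++ outStar C (C.trans q a) u

/-- The output `C(u)` of the compressor on the input string `u`. -/
def output (C : FSC A Q) (u : List A) : List Bool := C.outStar C.init u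

theorem transStar_append_singleton (C : FSC A Q) (q : Q) (u : List A) (a : A) :
    C.transStar q (u ++ [a]) = C.trans (C.transStar q u) a := by
  simp [transStar]

theorem outStar_append_singleton (C : FSC A Q) (q : Q) (u : List A) (a : A) :
    C.outStar q (u ++ [a]) = C.outStar q u ++ C.out (C.transStar q u) a := by
  induction u generalizing q with
  | nil => simp [outStar, transStar]
  | cons b u ih => simp [outStar, ih, transStar]

/-- Information-losslessness: the map `u ↦ (C(u), δ*(u))` is one-to-one on all strings. -/
def IsLossless (C : FSC A Q) : Prop :=
  Function.Injective fun u : List A => (C.output u, C.transStar C.init u)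

end FSC

/-! ### Compression ratios of strings

Strings of length `n` over `A` are functions `Fin n → A`; sequences are functions `ℕ → A`.
All entropies and code lengths are measured in bits. -/

/-- The string of pairs `(u, w)` of two strings of the same length. -/
def pairString {A : Type*} {n : ℕ} (u w : Fin n → A) : Fin n → A × A := fun i => (u i, w i)

/-- The sequence of pairs `(S, T)`. -/
def pairSeq {A : Type*} (S T : ℕ → A) : ℕ → A × A := fun i => (S i, T i)

/-- The first `n` symbols of a sequence. -/
def pref {A : Type*} (S : ℕ → A) (n : ℕ) : Fin n → A := fun i => S i

/-- `|C(u)| / (n log k)`, for `u` of length `n` over the `k`-letter alphabet `A`. -/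
noncomputable def compRatio {A Q : Type*} [Fintype A] (C : FSC A Q) {n : ℕ} (u : Fin n → A) : ℝ :=
  ((C.output (List.ofFn u)).length : ℝ) / (n * Real.logb 2 (Fintype.card A))

/-- `|C((u,w))| / (n log k)`, for a compressor `C` on `A × A` and `k` the size of `A`
(not of `A × A`). -/
noncomputable def jointCompRatio {A Q : Type*} [Fintype A] (C : FSC (A × A) Q) {n : ℕ}
    (u w : Fin n → A) : ℝ :=
  ((C.output (List.ofFn (pairString u w))).length : ℝ) / (n * Real.logb 2 (Fintype.card A))

/-- The `r`-state compression ratio `ρ_r(u)`: the minimum over lossless compressors on `A` with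
exactly `r` states. (For `r ≥ 1` the set of values is a nonempty set of natural multiples of one
nonnegative number, so the infimum is a minimum.) -/
noncomputable def stateRatio {A : Type*} [Fintype A] (r : ℕ) {n : ℕ} (u : Fin n → A) : ℝ :=
  sInf {x : ℝ | ∃ (Q : Type) (_ : Fintype Q) (C : FSC A Q),
    Fintype.card Q = r ∧ C.IsLossless ∧ x = compRatio C u}

/-- The `r`-state joint compression ratio `ρ_r(u, w)`. -/
noncomputable def jointStateRatio {A : Type*} [Fintype A] (r : ℕ) {n : ℕ} (u w : Fin n → A) : ℝ :=
  sInf {x : ℝ | ∃ (Q : Type) (_ : Fintype Q) (C : FSC (A × A) Q),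
    Fintype.card Q = r ∧ C.IsLossless ∧ x = jointCompRatio C u w}

/-- The `r,t`-state mutual compression ratio `ρ_{r,t}(u : w) = ρ_t(u) + ρ_t(w) - ρ_r(u, w)`. -/
noncomputable def mutualStateRatio {A : Type*} [Fintype A] (r t : ℕ) {n : ℕ}
    (u w : Fin n → A) : ℝ :=
  stateRatio t u + stateRatio t w - jointStateRatio r u w

/-! ### Finite-state mutual dimensions of sequences -/

/-- The lower `r,t`-state mutual compression ratio between sequences. -/
noncomputable def lowerMutualRatio {A : Type*} [Fintype A] (S T : ℕ → A) (r t : ℕ) : ℝ :=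
  liminf (fun n : ℕ => mutualStateRatio r t (pref S n) (pref T n)) atTop

/-- The upper `r,t`-state mutual compression ratio between sequences. -/
noncomputable def upperMutualRatio {A : Type*} [Fintype A] (S T : ℕ → A) (r t : ℕ) : ℝ :=
  limsup (fun n : ℕ => mutualStateRatio r t (pref S n) (pref T n)) atTop

/-- The iterated limit `lim_{r → ∞} lim_{t → ∞} f r t` exists (with the inner limit existing for
every `r ≥ 1`) and equals `d`. -/
def HasIteratedLimit (f : ℕ → ℕ → ℝ) (d : ℝ) : Prop :=
  ∃ L : ℕ → ℝ, (∀ r, 1 ≤ r → Tendsto (fun t => f r t) atTop (𝓝 (L r))) ∧ Tendsto L atTop (𝓝 d)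

/-- The lower finite-state mutual dimension `mdim_FS(S : T)`. -/
noncomputable def lowerMutualDim {A : Type*} [Fintype A] (S T : ℕ → A) : ℝ :=
  limUnder atTop fun r : ℕ => limUnder atTop fun t : ℕ => lowerMutualRatio S T r t

/-- The upper finite-state mutual dimension `Mdim_FS(S : T)`. -/
noncomputable def upperMutualDim {A : Type*} [Fintype A] (S T : ℕ → A) : ℝ :=
  limUnder atTop fun r : ℕ => limUnder atTop fun t : ℕ => upperMutualRatio S T r t

/-! ### Entropy, mutual information and normality -/

/-- Shannon entropy in bits (a term with `α x = 0` contributes `0`). -/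
noncomputable def entropy {X : Type*} [Fintype X] (α : X → ℝ) : ℝ :=
  ∑ x, α x * Real.logb 2 (1 / α x)

/-- First marginal. -/
def marginalFst {X : Type*} [Fintype X] (α : X × X → ℝ) : X → ℝ := fun a => ∑ b, α (a, b)

/-- Second marginal. -/
def marginalSnd {X : Type*} [Fintype X] (α : X × X → ℝ) : X → ℝ := fun b => ∑ a, α (a, b)

/-- Shannon mutual information between the two marginals of the joint measure `α`. -/
noncomputable def mutualInfo {X : Type*} [Fintype X] (α : X × X → ℝ) : ℝ :=
  entropy (marginalFst α) + entropy (marginalSnd α) - entropy α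

open Classical in
/-- The frequency of the string `x` of length `ℓ` among the first `n` aligned blocks of length
`ℓ` of the sequence `S`. -/
noncomputable def blockFreq {B : Type*} {ℓ : ℕ} (S : ℕ → B) (n : ℕ) (x : Fin ℓ → B) : ℝ :=
  (((Finset.range n).filter fun m => ∀ i : Fin ℓ, S (m * ℓ + i) = x i).card : ℝ) / n

/-- `S` is `α`-normal: for every `ℓ ≥ 1` every string `x` of length `ℓ` has limiting aligned block
frequency `α(x) = ∏ i, α (x i)`. -/
def IsNormalSeq {B : Type*} (α : B → ℝ) (S : ℕ → B) : Prop :=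
  ∀ ℓ : ℕ, 1 ≤ ℓ → ∀ x : Fin ℓ → B,
    Tendsto (fun n : ℕ => blockFreq S n x) atTop (𝓝 (∏ i, α (x i)))

end FSMutual

/-! Finite-state compression of a normal sequence reaches exactly its entropy rate. Mutual
information then appears because $\alpha$-normality of the pair sequence passes to $\alpha_1$- and
$\alpha_2$-normality of the coordinates (`IsNormalSeq.map`), so three entropy rates combine.

Lower bound (`IsNormalSeq.eventually_le_length`). Start state, end state and output determine the
input of a lossless compressor, so with $r$ states at most $r^2 2^j$ blocks of length $l$ have
shortest output of length $j$. Gibbs' inequality makes the mean shortest output under the product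
measure at least $l H(\alpha) - O(\log r + \log l)$, and normality carries this over to the
empirical mean. The estimate is uniform in the compressor, as it must be: the optimal one changes
with $n$.

Upper bound (`IsNormalSeq.exists_block_length_le`). A Shannon code on blocks, each word preceded by
a short header giving its length, is prefix-free and costs $O(\log l)$ extra bits per block.

For all large $r,t$ the mutual ratio is therefore eventually near $I(\alpha_1;\alpha_2)/\log k$. The
inner limits exist because more states only lower $\rho_t$. -/

namespace FSMutual

/-! ### Lossless compressors: counting inputs by output length, padding the state set -/

namespace FSC

variable {A Q : Type*}

theorem transStar_append (C : FSC A Q) (q : Q) (u v : List A) :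
    C.transStar q (u ++ v) = C.transStar (C.transStar q u) v := by
  simp [transStar]

theorem outStar_append (C : FSC A Q) (q : Q) (u v : List A) :
    C.outStar q (u ++ v) = C.outStar q u ++ C.outStar (C.transStar q u) v := by
  induction u generalizing q with
  | nil => simp [outStar, transStar]
  | cons b u ih => simp [outStar, ih, transStar]

/-- A state that is reached from the initial state by some input string. -/
def Reachable (C : FSC A Q) (q : Q) : Prop := ∃ w, C.transStar C.init w = q

theorem reachable_transStar (C : FSC A Q) (w : List A) :
    C.Reachable (C.transStar C.init w) := ⟨w, rfl⟩

/-- Losslessness only speaks of runs from `init`; prepending a word that leads to `q` transfers it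
to `q`. -/
theorem IsLossless.eq_of_reachable {C : FSC A Q} (hC : C.IsLossless) {q : Q}
    (hq : C.Reachable q) {u v : List A} (ho : C.outStar q u = C.outStar q v)
    (ht : C.transStar q u = C.transStar q v) : u = v := by
  obtain ⟨w, rfl⟩ := hq
  have h : w ++ u = w ++ v := hC (by
    simp only [output, outStar_append, transStar_append, ho, ht])
  exact List.append_cancel_left h

/-- The shortest output on the input `u` from a reachable state. -/
noncomputable def minLength (C : FSC A Q) (u : List A) : ℕ :=
  sInf {m | ∃ q, C.Reachable q ∧ (C.outStar q u).length = m}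

theorem minLength_le (C : FSC A Q) {q : Q} (hq : C.Reachable q) (u : List A) :
    C.minLength u ≤ (C.outStar q u).length :=
  Nat.sInf_le ⟨q, hq, rfl⟩

theorem exists_minLength (C : FSC A Q) (u : List A) :
    ∃ q, C.Reachable q ∧ (C.outStar q u).length = C.minLength u :=
  Nat.sInf_mem (s := {m | ∃ q, C.Reachable q ∧ (C.outStar q u).length = m})
    ⟨_, C.init, ⟨[], rfl⟩, rfl⟩

open Classical in
/-- A lossless compressor with `r` states has few strings of a given short output length. -/
theorem IsLossless.card_minLength_le [Fintype A] [Fintype Q] {C : FSC A Q} (hC : C.IsLossless)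
    (l j : ℕ) :
    (Finset.univ.filter fun x : Fin l → A => C.minLength (List.ofFn x) = j).card ≤
      Fintype.card Q ^ 2 * 2 ^ j := by
  -- Encode `x` by the state where the minimum is attained, the end state and the output. The two
  -- states account for the factor `Fintype.card Q ^ 2`.
  choose s hs hl using fun x : Fin l → A => C.exists_minLength (List.ofFn x)
  let f : {x : Fin l → A // C.minLength (List.ofFn x) = j} → Q × Q × List.Vector Bool j :=
    fun x => (s x, C.transStar (s x) (List.ofFn x.1),
      ⟨C.outStar (s x) (List.ofFn x.1), (hl x).trans x.2⟩)
  have hf : Function.Injective f := by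
    rintro ⟨x, hx⟩ ⟨y, hy⟩ h
    have h1 : s x = s y := congrArg Prod.fst h
    have h2 : C.transStar (s x) (List.ofFn x) = C.transStar (s y) (List.ofFn y) :=
      congrArg (fun z => z.2.1) h
    have h3 : C.outStar (s x) (List.ofFn x) = C.outStar (s y) (List.ofFn y) :=
      congrArg (fun z => z.2.2.1) h
    rw [← h1] at h2 h3
    exact Subtype.ext (List.ofFn_injective (hC.eq_of_reachable (hs x) h3 h2))
  have := Fintype.card_le_of_injective f hf
  rw [Fintype.card_subtype] at this
  refine this.trans (le_of_eq ?_)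
  simp [card_vector]
  ring

/-- Transport of a compressor along an injection of state sets with left inverse `g`. -/
def extend {Q' : Type*} (C : FSC A Q) (e : Q → Q') (g : Q' → Q) : FSC A Q' where
  trans s a := e (C.trans (g s) a)
  out s a := C.out (g s) a
  init := e C.init

section extend
variable {Q' : Type*} (C : FSC A Q) {e : Q → Q'} {g : Q' → Q} (h : Function.LeftInverse g e)
include h

theorem extend_transStar (q : Q) (u : List A) :
    (C.extend e g).transStar (e q) u = e (C.transStar q u) := by
  induction u generalizing q with
  | nil => rfl
  | cons a u ih =>
    have := ih (C.trans q a)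
    simpa [transStar, extend, h q] using this

theorem extend_outStar (q : Q) (u : List A) :
    (C.extend e g).outStar (e q) u = C.outStar q u := by
  induction u generalizing q with
  | nil => rfl
  | cons a u ih =>
    have := ih (C.trans q a)
    simp only [outStar]
    simpa [extend, h q] using this

theorem extend_output (u : List A) : (C.extend e g).output u = C.output u :=
  C.extend_outStar h C.init u

theorem IsLossless.extend {C : FSC A Q} (hC : C.IsLossless) :
    (C.extend e g).IsLossless := by
  intro u v huv
  simp only [Prod.mk.injEq] at huv
  have h1 := huv.2
  change (C.extend e g).transStar (e C.init) u = (C.extend e g).transStar (e C.init) v at h1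
  rw [C.extend_transStar h, C.extend_transStar h] at h1
  have h2 := huv.1
  rw [C.extend_output h, C.extend_output h] at h2
  exact hC (Prod.ext h2 (h.injective h1))

end extend

/-! ### Block compressors -/

/-- The compressor that reads blocks of length `l` and writes the code word of each block. -/
def block {l : ℕ} (hl : 0 < l) (code : List A → List Bool) : FSC A {w : List A // w.length < l} where
  trans q a := if h : q.1.length + 1 < l then ⟨q.1 ++ [a], by simpa using h⟩ else ⟨[], hl⟩
  out q a := if q.1.length + 1 < l then [] else code (q.1 ++ [a])
  init := ⟨[], hl⟩

section block
variable {l : ℕ} (hl : 0 < l) (code : List A → List Bool)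

theorem block_short (q u : List A) (hq : q.length < l) (h : (q ++ u).length < l) :
    (block hl code).transStar ⟨q, hq⟩ u = ⟨q ++ u, h⟩ ∧
      (block hl code).outStar ⟨q, hq⟩ u = [] := by
  induction u generalizing q with
  | nil => simp [transStar, outStar]
  | cons a u ih =>
    have h' : q.length + 1 < l := by simp at h; omega
    have := ih (q ++ [a]) (by simpa using h') (by simpa using h)
    simpa [transStar, outStar, block, h'] using this

theorem block_full (q u : List A) (hq : q.length < l) (h : (q ++ u).length = l) :
    (block hl code).transStar ⟨q, hq⟩ u = ⟨[], hl⟩ ∧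
      (block hl code).outStar ⟨q, hq⟩ u = code (q ++ u) := by
  induction u generalizing q with
  | nil => simp at h; omega
  | cons a u ih =>
    rcases eq_or_ne u [] with rfl | hu
    · have h' : ¬ q.length + 1 < l := by simp at h; omega
      simp [transStar, outStar, block, h']
    · have h' : q.length + 1 < l := by
        have := List.length_pos_of_ne_nil hu
        simp at h; omega
      have := ih (q ++ [a]) (by simpa using h') (by simpa using h)
      simpa [transStar, outStar, block, h'] using this

theorem block_output_short {u : List A} (h : u.length < l) :
    (block hl code).output u = [] ∧
      (block hl code).transStar (block hl code).init u = ⟨u, h⟩ :=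
  ⟨(block_short hl code [] u hl (by simpa using h)).2,
    (block_short hl code [] u hl (by simpa using h)).1⟩

theorem block_output_append {x : List A} (h : x.length = l) (u : List A) :
    (block hl code).output (x ++ u) = code x ++ (block hl code).output u ∧
      (block hl code).transStar (block hl code).init (x ++ u) =
        (block hl code).transStar (block hl code).init u := by
  have hx := block_full hl code [] x hl (by simpa using h)
  have hi : (block hl code).init = ⟨[], hl⟩ := rfl
  rw [output, outStar_append, transStar_append, output, hi, hx.1, hx.2]
  exact ⟨rfl, rfl⟩

/-- A block compressor with a prefix code is lossless. -/
theorem block_isLossless (hne : ∀ x, code x ≠ [])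
    (hpre : ∀ x y s t, x.length = l → y.length = l → code x ++ s = code y ++ t → x = y ∧ s = t) :
    (block hl code).IsLossless := by
  -- Whole blocks are peeled off both inputs. A remainder shorter than `l` is the state itself, and
  -- a short input is told from a long one because code words are nonempty.
  have key : ∀ n (u v : List A), u.length ≤ n →
      (block hl code).output u = (block hl code).output v →
      (block hl code).transStar (block hl code).init u =
        (block hl code).transStar (block hl code).init v → u = v := by
    intro n
    induction n using Nat.strong_induction_on with
    | _ n ih =>
    intro u v hn ho ht
    have split : ∀ w : List A, l ≤ w.length → ∃ x w', x.length = l ∧ w = x ++ w' := fun w hw =>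
      ⟨w.take l, w.drop l, by simpa using hw, (List.take_append_drop l w).symm⟩
    rcases lt_or_ge u.length l with hu | hu <;> rcases lt_or_ge v.length l with hv | hv
    · rw [(block_output_short hl code hu).2, (block_output_short hl code hv).2] at ht
      exact congrArg Subtype.val ht
    · obtain ⟨y, v, hy, rfl⟩ := split v hv
      rw [(block_output_short hl code hu).1, (block_output_append hl code hy v).1] at ho
      exact absurd (List.append_eq_nil_iff.1 ho.symm).1 (hne y)
    · obtain ⟨x, u, hx, rfl⟩ := split u hu
      rw [(block_output_short hl code hv).1, (block_output_append hl code hx u).1] at ho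
      exact absurd (List.append_eq_nil_iff.1 ho).1 (hne x)
    · obtain ⟨x, u, hx, rfl⟩ := split u hu
      obtain ⟨y, v, hy, rfl⟩ := split v hv
      rw [(block_output_append hl code hx u).1, (block_output_append hl code hy v).1] at ho
      rw [(block_output_append hl code hx u).2, (block_output_append hl code hy v).2] at ht
      obtain ⟨hxy, ho'⟩ := hpre x y _ _ hx hy ho
      rw [hxy, ih u.length (by simp at hn; omega) u v le_rfl ho' ht]
  intro u v h
  simp only [Prod.mk.injEq] at h
  exact key _ u v le_rfl h.1 h.2

end block

end FSC

/-! ### Outputs on prefixes of sequences, block by block -/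

section blocks
variable {B : Type*}

/-- The `m`-th aligned block of length `l` of a sequence. -/
def seqBlock (S : ℕ → B) (l m : ℕ) : Fin l → B := fun i => S (m * l + i)

theorem ofFn_pref (S : ℕ → B) (n : ℕ) : List.ofFn (pref S n) = (List.range n).map S := by
  apply List.ext_getElem <;> simp [pref]

theorem ofFn_pref_add (S : ℕ → B) (a b : ℕ) :
    List.ofFn (pref S (a + b)) =
      List.ofFn (pref S a) ++ List.ofFn (pref (fun i => S (a + i)) b) := by
  simp only [ofFn_pref, List.range_add, List.map_append, List.map_map]
  rfl

/-- Whatever state the compressor is in when a block starts, that state is reachable; passing to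
`minLength` removes the dependence on the past. -/
theorem FSC.sum_minLength_le {Q : Type*} (C : FSC B Q) (S : ℕ → B) (l N : ℕ) :
    ∑ m ∈ Finset.range N, C.minLength (List.ofFn (seqBlock S l m)) ≤
      (C.output (List.ofFn (pref S (N * l)))).length := by
  induction N with
  | zero => simp
  | succ N ih =>
    rw [Finset.sum_range_succ, Nat.succ_mul, ofFn_pref_add, FSC.output, FSC.outStar_append,
      List.length_append]
    exact add_le_add ih (C.minLength_le (C.reachable_transStar _) _)

theorem FSC.length_output_mono {Q : Type*} (C : FSC B Q) (S : ℕ → B) {a b : ℕ} (h : a ≤ b) :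
    (C.output (List.ofFn (pref S a))).length ≤ (C.output (List.ofFn (pref S b))).length := by
  obtain ⟨d, rfl⟩ := Nat.exists_eq_add_of_le h
  rw [ofFn_pref_add, FSC.output, FSC.output, FSC.outStar_append, List.length_append]
  exact Nat.le_add_right _ _

theorem FSC.length_block_output {l : ℕ} (hl : 0 < l) (code : List B → List Bool) (S : ℕ → B)
    (N d : ℕ) (hd : d < l) :
    ((FSC.block hl code).output (List.ofFn (pref S (N * l + d)))).length =
      ∑ m ∈ Finset.range N, (code (List.ofFn (seqBlock S l m))).length := by
  induction N generalizing S with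
  | zero =>
    rw [(FSC.block_output_short hl code (by simpa using hd)).1]
    simp
  | succ N ih =>
    rw [show (N + 1) * l + d = l + (N * l + d) by ring, ofFn_pref_add,
      (FSC.block_output_append hl code (by simp) _).1, List.length_append, ih,
      Finset.sum_range_succ', add_comm]
    congr 1
    · refine Finset.sum_congr rfl fun m _ => ?_
      have : seqBlock (fun i => S (l + i)) l m = seqBlock S l (m + 1) := by
        funext i; simp only [seqBlock]; congr 1; ring
      rw [this]
    · have : pref S l = seqBlock S l 0 := by funext i; simp [pref, seqBlock]
      rw [this]

end blocks

/-! ### Entropy estimates -/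

section entropy
variable {X : Type*} [Fintype X]

/-- Gibbs' inequality for code lengths with an arbitrary Kraft sum. -/
theorem entropy_le_sum_add_logb {p : X → ℝ} (hp : p ∈ stdSimplex ℝ X) (L : X → ℕ) {Z : ℝ}
    (hZ : 0 < Z) (hL : ∑ x, (2 : ℝ)⁻¹ ^ L x ≤ Z) :
    entropy p ≤ ∑ x, p x * L x + Real.logb 2 Z := by
  have h2 : (0 : ℝ) < Real.log 2 := Real.log_pos one_lt_two
  -- This is `log y ≤ y - 1` at `y = 2⁻¹ ^ L x / (Z * p x)`, multiplied by `p x`.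
  have key : ∀ x, p x * Real.log (1 / p x) - p x * L x * Real.log 2 - p x * Real.log Z ≤
      (2 : ℝ)⁻¹ ^ L x / Z - p x := by
    intro x
    rcases (hp.1 x).eq_or_lt with h | h
    · rw [← h]; simp; positivity
    · have h3 : (0 : ℝ) < (2 : ℝ)⁻¹ ^ L x / (Z * p x) := by positivity
      have h4 := Real.log_le_sub_one_of_pos h3
      rw [Real.log_div (by positivity) (by positivity), Real.log_pow, Real.log_inv,
        Real.log_mul hZ.ne' h.ne'] at h4
      have h5 := mul_le_mul_of_nonneg_left h4 h.le
      rw [one_div, Real.log_inv]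
      have h6 : p x * ((2 : ℝ)⁻¹ ^ L x / (Z * p x) - 1) = (2 : ℝ)⁻¹ ^ L x / Z - p x := by
        field_simp
      rw [h6] at h5
      linarith
  have hs := Finset.sum_le_sum fun x (_ : x ∈ Finset.univ) => key x
  simp only [Finset.sum_sub_distrib, ← Finset.sum_mul, ← Finset.sum_div, hp.2] at hs
  have h7 : (∑ x, (2 : ℝ)⁻¹ ^ L x) / Z ≤ 1 := (div_le_one hZ).2 hL
  have h8 : entropy p = (∑ x, p x * Real.log (1 / p x)) / Real.log 2 := by
    simp only [entropy, Real.logb, Finset.sum_div, mul_div_assoc]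
  rw [h8, Real.logb, div_le_iff₀ h2, add_mul, div_mul_cancel₀ _ h2.ne']
  linarith

open Classical in
/-- Lower bound for truncated lengths with few points of each length. -/
theorem entropy_le_of_card_le {p : X → ℝ} (hp : p ∈ stdSimplex ℝ X) (L : X → ℕ) {K J : ℕ}
    (hK : 1 ≤ K) (hX : Fintype.card X ≤ 2 ^ J)
    (hL : ∀ j, (Finset.univ.filter fun x => L x = j).card ≤ K * 2 ^ j) :
    entropy p ≤ ∑ x, p x * (min (L x) J : ℕ) + Real.logb 2 (K * (J + 1)) := by
  refine entropy_le_sum_add_logb hp _ (by positivity) ?_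
  have hmem : ∀ x ∈ Finset.univ, min (L x) J ∈ Finset.range (J + 1) := fun x _ =>
    Finset.mem_range.2 (Nat.lt_succ_of_le (min_le_right _ _))
  rw [← Finset.sum_fiberwise_of_maps_to hmem]
  have hcard : ∀ j ∈ Finset.range (J + 1),
      (Finset.univ.filter fun x => min (L x) J = j).card ≤ K * 2 ^ j := by
    intro j hj
    -- Truncation leaves `J + 1` possible lengths, each adding at most `K` to the Kraft sum. Length
    -- `J` absorbs all longer ones, and there `hX` bounds the count.
    rcases (Nat.lt_succ_iff.1 (Finset.mem_range.1 hj)).eq_or_lt with rfl | h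
    · refine (Finset.card_le_univ _).trans (hX.trans ?_)
      exact Nat.le_mul_of_pos_left _ hK
    · refine (Finset.card_le_card fun x hx => ?_).trans (hL j)
      simp only [Finset.mem_filter, Finset.mem_univ, true_and] at hx ⊢
      omega
  calc ∑ j ∈ Finset.range (J + 1), ∑ x with min (L x) J = j, (2 : ℝ)⁻¹ ^ min (L x) J
      ≤ ∑ j ∈ Finset.range (J + 1), (K : ℝ) := by
        refine Finset.sum_le_sum fun j hj => ?_
        rw [Finset.sum_congr rfl (g := fun _ => (2 : ℝ)⁻¹ ^ j) fun x hx => by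
          rw [(Finset.mem_filter.1 hx).2], Finset.sum_const, nsmul_eq_mul]
        have : ((Finset.univ.filter fun x => min (L x) J = j).card : ℝ) ≤ K * 2 ^ j := by
          exact_mod_cast hcard j hj
        calc _ ≤ (K * 2 ^ j : ℝ) * (2 : ℝ)⁻¹ ^ j := by gcongr
          _ = K := by rw [mul_assoc, ← mul_pow]; norm_num
    _ = K * (J + 1) := by simp; ring

/-- A prefix code whose words exceed the Shannon lengths by a logarithmic header only. -/
theorem exists_prefix_code {p : X → ℝ} (hp : p ∈ stdSimplex ℝ X) {J D : ℕ}
    (hX : Fintype.card X ≤ 2 ^ J) (hD : J + 1 ≤ 2 ^ D) (hD0 : 0 < D) :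
    ∃ code : X → List Bool, (∀ x, code x ≠ []) ∧
      (∀ x y s t, code x ++ s = code y ++ t → x = y ∧ s = t) ∧
      (∑ x, p x * (code x).length ≤ entropy p + 1 + D) ∧
      ∀ x, (code x).length ≤ J + D := by
  classical
  -- At most `2 ^ j` points get length `j`: for `j < J` each has mass at least `2⁻ʲ`, and for `j =
  -- J` this is `hX`. Null points need their own case, since `logb 2 (1 / 0) = 0` would give them
  -- length 0.
  let L : X → ℕ := fun x => if p x = 0 then J else min J ⌈Real.logb 2 (1 / p x)⌉₊
  have hLJ : ∀ x, L x ≤ J := fun x => by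
    simp only [L]; split_ifs <;> simp
  have hcard : ∀ j, Fintype.card {x // L x = j} ≤ Fintype.card (List.Vector Bool j) := by
    intro j
    rw [card_vector, Fintype.card_bool, Fintype.card_subtype]
    rcases lt_trichotomy j J with h | rfl | h
    · have h1 : ∀ x ∈ Finset.univ.filter fun x => L x = j, (2 : ℝ)⁻¹ ^ j ≤ p x := by
        intro x hx
        have hx := (Finset.mem_filter.1 hx).2
        simp only [L] at hx
        split_ifs at hx with h0
        · omega
        have hpos : 0 < p x := (hp.1 x).lt_of_ne' h0
        have h3 : ⌈Real.logb 2 (1 / p x)⌉₊ = j := by omega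
        have h4 : Real.logb 2 (1 / p x) ≤ j := by rw [← h3]; exact Nat.le_ceil _
        rw [Real.logb_le_iff_le_rpow one_lt_two (by positivity), Real.rpow_natCast] at h4
        rw [inv_pow, inv_le_comm₀ (by positivity) hpos, ← one_div]
        exact h4
      have h2 := (Finset.sum_le_sum h1).trans
        (Finset.sum_le_univ_sum_of_nonneg hp.1)
      rw [hp.2, Finset.sum_const, nsmul_eq_mul, inv_pow, ← div_eq_mul_inv,
        div_le_one (by positivity)] at h2
      exact_mod_cast h2
    · exact (Finset.card_le_univ _).trans hX
    · rw [Finset.card_eq_zero.2]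
      · exact Nat.zero_le _
      · refine Finset.filter_eq_empty_iff.2 fun x _ hx => ?_
        have := hLJ x; omega
  have hemb : ∀ j, Nonempty ({x // L x = j} ↪ List.Vector Bool j) := fun j =>
    Function.Embedding.nonempty_of_card_le (hcard j)
  let idx : ∀ j, {x // L x = j} ↪ List.Vector Bool j := fun j => (hemb j).some
  -- The `D`-bit header announces which fixed-length code follows; this makes the whole code
  -- prefix-free.
  obtain ⟨hdr⟩ : Nonempty (Fin (J + 1) ↪ List.Vector Bool D) :=
    Function.Embedding.nonempty_of_card_le (by simpa [card_vector] using hD)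
  let code : X → List Bool := fun x =>
    (hdr ⟨L x, Nat.lt_succ_of_le (hLJ x)⟩).1 ++ (idx (L x) ⟨x, rfl⟩).1
  have hlen : ∀ x, (code x).length = D + L x := fun x => by
    simp only [code, List.length_append, (hdr _).2, (idx _ _).2]
  refine ⟨code, fun x h => ?_, fun x y s t h => ?_, ?_, fun x => ?_⟩
  · have := hlen x
    rw [h, List.length_nil] at this; omega
  · simp only [code, List.append_assoc] at h
    obtain ⟨h1, h2⟩ := List.append_inj h (by rw [(hdr _).2, (hdr _).2])
    have h3 : L x = L y := congrArg Fin.val (hdr.injective (Subtype.ext h1))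
    have aux : ∀ j (hj : L y = j), (idx (L y) ⟨y, rfl⟩).1 = (idx j ⟨y, hj⟩).1 := by
      rintro j rfl; rfl
    rw [aux (L x) h3.symm] at h2
    obtain ⟨h4, h5⟩ := List.append_inj h2 (by rw [(idx _ _).2, (idx _ _).2])
    exact ⟨congrArg Subtype.val ((idx (L x)).injective (Subtype.ext h4)), h5⟩
  · have hb : ∀ x, p x * (code x).length ≤ p x * Real.logb 2 (1 / p x) + p x * (1 + D) := by
      intro x
      rw [hlen]
      rcases (hp.1 x).eq_or_lt with h | h
      · simp [← h]
      · have h1 : p x ≤ 1 := by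
          rw [← hp.2]; exact Finset.single_le_sum (fun i _ => hp.1 i) (Finset.mem_univ x)
        have h2 : 0 ≤ Real.logb 2 (1 / p x) :=
          Real.logb_nonneg one_lt_two (by rw [le_div_iff₀ h]; linarith)
        have h3 : (L x : ℝ) ≤ Real.logb 2 (1 / p x) + 1 := by
          refine le_trans ?_ (Nat.ceil_lt_add_one h2).le
          have : L x ≤ ⌈Real.logb 2 (1 / p x)⌉₊ := by simp [L, h.ne']
          exact_mod_cast this
        rw [← mul_add]
        push_cast
        exact mul_le_mul_of_nonneg_left (by linarith) h.le
    refine (Finset.sum_le_sum fun x _ => hb x).trans (le_of_eq ?_)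
    rw [Finset.sum_add_distrib, ← Finset.sum_mul, hp.2, entropy]; ring
  · rw [hlen]; have := hLJ x; omega

theorem entropy_nonneg {p : X → ℝ} (hp : p ∈ stdSimplex ℝ X) : 0 ≤ entropy p := by
  refine Finset.sum_nonneg fun x _ => ?_
  rcases (hp.1 x).eq_or_lt with h | h
  · simp [← h]
  · have h1 : p x ≤ 1 := by
      rw [← hp.2]; exact Finset.single_le_sum (fun i _ => hp.1 i) (Finset.mem_univ x)
    exact mul_nonneg h.le (Real.logb_nonneg one_lt_two (by rw [le_div_iff₀ h]; linarith))

end entropy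

/-! ### Product measures on blocks -/

section product
variable {B : Type*} [Fintype B]

/-- The product measure on strings of length `l`. -/
def prodMeasure (α : B → ℝ) (l : ℕ) (x : Fin l → B) : ℝ := ∏ i, α (x i)

theorem sum_prod_eq_prod_sum {l : ℕ} (g : Fin l → B → ℝ) :
    ∑ x : Fin l → B, ∏ i, g i (x i) = ∏ i, ∑ b, g i b := by
  classical
  rw [Finset.prod_univ_sum, Fintype.piFinset_univ]

theorem prodMeasure_mem_stdSimplex {α : B → ℝ} (hα : α ∈ stdSimplex ℝ B) (l : ℕ) :
    prodMeasure α l ∈ stdSimplex ℝ (Fin l → B) := by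
  refine ⟨fun x => Finset.prod_nonneg fun i _ => hα.1 _, ?_⟩
  simp only [prodMeasure]
  rw [sum_prod_eq_prod_sum fun _ => α]
  simp [hα.2]

/-- All coordinates other than `i` integrate to 1. -/
theorem sum_prodMeasure_mul {α : B → ℝ} (hα : α ∈ stdSimplex ℝ B) {l : ℕ} (i : Fin l)
    (f : B → ℝ) : ∑ x, prodMeasure α l x * f (x i) = ∑ b, α b * f b := by
  classical
  have h := sum_prod_eq_prod_sum fun (j : Fin l) b => α b * if j = i then f b else 1
  simp only [Finset.prod_mul_distrib, Finset.prod_ite_eq', Finset.mem_univ, if_true] at h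
  rw [show ∑ x, prodMeasure α l x * f (x i) = _ from h, Finset.prod_eq_single i]
  · simp
  · intro j _ hj; simp [hj, hα.2]
  · simp

/-- The logarithm of the product splits only when no factor vanishes; strings of measure zero
contribute 0 to both sides. -/
theorem entropy_prodMeasure {α : B → ℝ} (hα : α ∈ stdSimplex ℝ B) (l : ℕ) :
    entropy (prodMeasure α l) = l * entropy α := by
  have h : ∀ x, prodMeasure α l x * Real.logb 2 (1 / prodMeasure α l x) =
      ∑ i, prodMeasure α l x * Real.logb 2 (1 / α (x i)) := by
    intro x
    rw [← Finset.mul_sum]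
    by_cases h0 : prodMeasure α l x = 0
    · simp [h0]
    · congr 1
      simp only [one_div, Real.logb_inv, prodMeasure, Finset.sum_neg_distrib]
      rw [Real.logb_prod]
      exact fun i hi h1 => h0 (Finset.prod_eq_zero hi h1)
  rw [entropy, Finset.sum_congr rfl fun x _ => h x, Finset.sum_comm]
  simp_rw [sum_prodMeasure_mul hα _ fun b => Real.logb 2 (1 / α b)]
  simp [entropy]

end product

/-! ### Block frequencies -/

section freq
variable {B : Type*} [Fintype B]

/-- Grouping the blocks by their value turns a sum along the sequence into an expectation under the
empirical measure. -/
theorem sum_seqBlock {l : ℕ} (S : ℕ → B) {N : ℕ} (hN : 0 < N) (g : (Fin l → B) → ℝ) :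
    ∑ m ∈ Finset.range N, g (fun i => S (m * l + i)) = N * ∑ x, blockFreq S N x * g x := by
  classical
  have hN' : (N : ℝ) ≠ 0 := by positivity
  rw [← Finset.sum_fiberwise (Finset.range N) (fun m => (fun i : Fin l => S (m * l + i))),
    Finset.mul_sum]
  refine Finset.sum_congr rfl fun x _ => ?_
  rw [Finset.sum_congr rfl (g := fun _ => g x) fun m hm => by rw [(Finset.mem_filter.1 hm).2],
    Finset.sum_const, nsmul_eq_mul, blockFreq]
  simp only [funext_iff]
  field_simp

theorem blockFreq_marginal {A : Type*} [Fintype A] (f : B → A) (S : ℕ → B) {l : ℕ} (N : ℕ)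
    (x : Fin l → A) [DecidableEq A] :
    blockFreq (fun n => f (S n)) N x =
      ∑ y : Fin l → B with (fun i => f (y i)) = x, blockFreq S N y := by
  classical
  simp only [blockFreq]
  rw [← Finset.sum_div, ← Nat.cast_sum]
  congr 2
  rw [Finset.card_eq_sum_card_fiberwise (f := fun m => (fun i : Fin l => S (m * l + i)))
    (t := Finset.univ.filter fun y : Fin l → B => (fun i => f (y i)) = x)]
  · refine Finset.sum_congr rfl fun y hy => ?_
    have hy := (Finset.mem_filter.1 hy).2
    congr 1
    ext m
    simp only [Finset.mem_filter, Finset.mem_range, funext_iff]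
    constructor
    · rintro ⟨⟨h1, h2⟩, h3⟩; exact ⟨h1, h3⟩
    · rintro ⟨h1, h3⟩
      exact ⟨⟨h1, fun i => by rw [h3 i]; exact congrFun hy i⟩, h3⟩
  · intro m hm
    simp only [Finset.coe_filter, Finset.mem_range, Set.mem_ofPred_eq] at hm
    simp [funext_iff, hm.2]

/-- The image of a normal sequence under a letter-to-letter map is normal. -/
theorem IsNormalSeq.map {A : Type*} [Fintype A] [DecidableEq A] {α : B → ℝ} {S : ℕ → B}
    (h : IsNormalSeq α S) (f : B → A) :
    IsNormalSeq (fun a => ∑ b with f b = a, α b) (fun n => f (S n)) := by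
  classical
  intro l hl x
  simp_rw [blockFreq_marginal f S]
  have : ∏ i, (∑ b with f b = x i, α b) =
      ∑ y : Fin l → B with (fun i => f (y i)) = x, ∏ i, α (y i) := by
    rw [Finset.prod_univ_sum]
    refine Finset.sum_congr ?_ fun _ _ => rfl
    ext y; simp [Fintype.mem_piFinset, funext_iff]
  rw [this]
  exact tendsto_finsetSum _ fun y _ => h l hl y

theorem IsNormalSeq.fst {α : B × B → ℝ} {S T : ℕ → B} (h : IsNormalSeq α (pairSeq S T)) :
    IsNormalSeq (marginalFst α) S := by
  classical
  have hm : marginalFst α = fun a => ∑ b with b.1 = a, α b := by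
    funext a
    simp only [marginalFst, Finset.sum_filter, Fintype.sum_prod_type_right]
    simp
  rw [hm]
  exact h.map Prod.fst

theorem IsNormalSeq.snd {α : B × B → ℝ} {S T : ℕ → B} (h : IsNormalSeq α (pairSeq S T)) :
    IsNormalSeq (marginalSnd α) T := by
  classical
  have hm : marginalSnd α = fun a => ∑ b with b.2 = a, α b := by
    funext a
    simp only [marginalSnd, Finset.sum_filter, Fintype.sum_prod_type]
    simp
  rw [hm]
  exact h.map Prod.snd

theorem marginalFst_mem_stdSimplex {α : B × B → ℝ} (hα : α ∈ stdSimplex ℝ (B × B)) :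
    marginalFst α ∈ stdSimplex ℝ B :=
  ⟨fun _ => Finset.sum_nonneg fun _ _ => hα.1 _, by
    rw [← hα.2, Fintype.sum_prod_type]; rfl⟩

theorem marginalSnd_mem_stdSimplex {α : B × B → ℝ} (hα : α ∈ stdSimplex ℝ (B × B)) :
    marginalSnd α ∈ stdSimplex ℝ B :=
  ⟨fun _ => Finset.sum_nonneg fun _ _ => hα.1 _, by
    rw [← hα.2, Fintype.sum_prod_type_right]; rfl⟩

theorem IsNormalSeq.tendsto_sum {α : B → ℝ} {S : ℕ → B} (h : IsNormalSeq α S) {l : ℕ}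
    (hl : 1 ≤ l) (g : (Fin l → B) → ℝ) :
    Tendsto (fun N => ∑ x, blockFreq S N x * g x) atTop (𝓝 (∑ x, prodMeasure α l x * g x)) :=
  tendsto_finsetSum _ fun x _ => (h l hl x).mul_const _

/-- Convergence in $\ell^1$ controls all test functions with a common bound at once, as the lower
bound over all compressors requires; `tendsto_sum` handles one fixed function. -/
theorem IsNormalSeq.tendsto_dist {α : B → ℝ} {S : ℕ → B} (h : IsNormalSeq α S) {l : ℕ}
    (hl : 1 ≤ l) :
    Tendsto (fun N => ∑ x, |blockFreq S N x - prodMeasure α l x|) atTop (𝓝 0) := by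
  rw [← Finset.sum_const_zero (s := (Finset.univ : Finset (Fin l → B)))]
  refine tendsto_finsetSum _ fun x _ => ?_
  have := ((h l hl x).sub_const (prodMeasure α l x)).abs
  simpa [prodMeasure] using this

end freq

/-- Block lengths for which a logarithmic overhead is negligible. -/
theorem exists_blockLength (a : ℝ) (c : ℕ) {ε : ℝ} (hε : 0 < ε) :
    ∃ l D : ℕ, 1 ≤ l ∧ 0 < D ∧ c * l + 1 ≤ 2 ^ D ∧ a + D ≤ ε * l := by
  have h0 := tendsto_pow_const_div_const_pow_of_one_lt 0 (r := (2 : ℝ)) one_lt_two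
  have h1 := tendsto_pow_const_div_const_pow_of_one_lt 1 (r := (2 : ℝ)) one_lt_two
  have h := (h0.const_mul (a + c + 1)).add h1
  simp only [mul_zero, add_zero] at h
  obtain ⟨m, hm⟩ := (h.eventually_lt_const hε).exists
  -- `D` grows linearly in `m` while the block length grows exponentially.
  refine ⟨2 ^ m, c + 1 + m, Nat.one_le_two_pow, by omega, ?_, ?_⟩
  · have h2 : c < 2 ^ c := Nat.lt_two_pow_self
    have h3 : 1 ≤ 2 ^ m := Nat.one_le_two_pow
    rw [pow_add, pow_succ]
    nlinarith
  · have h4 : (0 : ℝ) < 2 ^ m := by positivity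
    simp only [pow_zero, pow_one] at hm
    rw [← mul_div_assoc, ← add_div, div_lt_iff₀ h4] at hm
    push_cast
    linarith

/-! ### Output lengths on normal sequences: lower and upper bounds -/

section rates
variable {B : Type*} [Fintype B]

theorem card_fun_le_two_pow (l : ℕ) :
    Fintype.card (Fin l → B) ≤ 2 ^ (Fintype.card B * l) := by
  classical
  rw [Fintype.card_fun, Fintype.card_fin, pow_mul]
  exact Nat.pow_le_pow_left Nat.lt_two_pow_self.le _

/-- On a normal sequence no lossless compressor with `r` states beats the entropy, uniformly
in the compressor. -/
theorem IsNormalSeq.eventually_le_length {α : B → ℝ} (hα : α ∈ stdSimplex ℝ B) {S : ℕ → B}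
    (h : IsNormalSeq α S) {r : ℕ} (hr : 1 ≤ r) {ε : ℝ} (hε : 0 < ε) :
    ∀ᶠ n : ℕ in atTop, ∀ (Q : Type) (_ : Fintype Q) (C : FSC B Q), Fintype.card Q = r →
      C.IsLossless → n * (entropy α - ε) ≤ (C.output (List.ofFn (pref S n))).length := by
  classical
  -- The three parts of `ε` pay for the logarithmic term, the distance from empirical to product
  -- measure, and the incomplete last block.
  obtain ⟨l, D, hl, -, hJD, hlD⟩ :=
    exists_blockLength (Real.logb 2 ((r ^ 2 : ℕ) : ℝ)) (Fintype.card B) (ε := ε / 3) (by positivity)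
  set J := Fintype.card B * l
  have hl0 : (0 : ℝ) < l := by exact_mod_cast hl
  have herr : ∀ᶠ N : ℕ in atTop,
      J * ∑ x : Fin l → B, |blockFreq S N x - prodMeasure α l x| < ε / 3 * l := by
    have := (h.tendsto_dist hl).const_mul (J : ℝ)
    rw [mul_zero] at this
    exact this.eventually_lt_const (by positivity)
  have hdiv : Tendsto (fun n : ℕ => n / l) atTop atTop := Nat.tendsto_div_const_atTop (by omega)
  have hlarge : ∀ᶠ n : ℕ in atTop, l * entropy α ≤ n * (ε / 3) :=
    (tendsto_natCast_atTop_atTop.atTop_mul_const (by positivity)).eventually_ge_atTop _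
  -- The threshold for `n` is fixed before `C` is introduced, hence the uniformity.
  filter_upwards [hdiv.eventually herr, hdiv.eventually (eventually_gt_atTop 0), hlarge]
    with n hn hN hnl Q _ C hQ hC
  set N := n / l
  have hp := prodMeasure_mem_stdSimplex hα l
  have hent := entropy_le_of_card_le hp (fun x => C.minLength (List.ofFn x))
    (K := r ^ 2) (J := J) (Nat.one_le_pow _ _ hr) (card_fun_le_two_pow l) fun j => by
      have := hC.card_minLength_le l j
      rwa [hQ] at this
  set g : (Fin l → B) → ℕ := fun x => min (C.minLength (List.ofFn x)) J
  have hlog : Real.logb 2 ((r ^ 2 : ℕ) * (J + 1)) ≤ ε / 3 * l := by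
    rw [Real.logb_mul (by positivity) (by positivity)]
    refine le_trans (add_le_add_right ?_ _) hlD
    rw [Real.logb_le_iff_le_rpow one_lt_two (by positivity), Real.rpow_natCast]
    exact_mod_cast hJD
  rw [entropy_prodMeasure hα] at hent
  have hlen : (N : ℝ) * ∑ x, blockFreq S N x * g x ≤
      (C.output (List.ofFn (pref S n))).length := by
    rw [← sum_seqBlock S hN fun x => (g x : ℝ), ← Nat.cast_sum, Nat.cast_le]
    calc ∑ m ∈ Finset.range N, g (seqBlock S l m)
        ≤ ∑ m ∈ Finset.range N, C.minLength (List.ofFn (seqBlock S l m)) :=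
          Finset.sum_le_sum fun m _ => min_le_left _ _
      _ ≤ _ := C.sum_minLength_le S l N
      _ ≤ _ := C.length_output_mono S (Nat.div_mul_le_self n l)
  have hdiff : ∑ x, prodMeasure α l x * g x - ∑ x, blockFreq S N x * g x ≤
      J * ∑ x : Fin l → B, |blockFreq S N x - prodMeasure α l x| := by
    rw [← Finset.sum_sub_distrib, Finset.mul_sum]
    refine Finset.sum_le_sum fun x _ => ?_
    have h1 : (g x : ℝ) ≤ J := by exact_mod_cast min_le_right _ _
    have h2 : (0 : ℝ) ≤ g x := by positivity
    rw [← sub_mul, mul_comm (J : ℝ), abs_sub_comm]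
    exact mul_le_mul (le_abs_self _) h1 h2 (abs_nonneg _)
  have hblock : l * (entropy α - 2 * ε / 3) ≤ ∑ x, blockFreq S N x * g x := by linarith
  have hNn : (n : ℝ) ≤ N * l + l := by
    have : n < (N + 1) * l := by
      rw [mul_comm]; exact Nat.lt_mul_div_succ n (by omega)
    have h3 : (n : ℝ) < (N + 1) * l := by exact_mod_cast this
    linarith
  -- A negative rate makes the claim trivial; otherwise its sign allows `n` to be replaced by the
  -- larger `N * l + l`.
  rcases lt_or_ge (entropy α - 2 * ε / 3) 0 with hneg | hpos
  · refine le_trans (mul_nonpos_of_nonneg_of_nonpos (by positivity) (by linarith)) (by positivity)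
  · refine le_trans ?_ hlen
    calc (n : ℝ) * (entropy α - ε)
        = n * (entropy α - 2 * ε / 3) - n * (ε / 3) := by ring
      _ ≤ (N * l + l) * (entropy α - 2 * ε / 3) - l * entropy α := by gcongr
      _ ≤ N * (l * (entropy α - 2 * ε / 3)) := by
        have : 0 ≤ l * (2 * ε / 3) := by positivity
        linarith
      _ ≤ _ := by gcongr

/-- On a normal sequence some lossless compressor comes close to the entropy. -/
theorem IsNormalSeq.exists_block_length_le {α : B → ℝ} (hα : α ∈ stdSimplex ℝ B) {S : ℕ → B}
    (h : IsNormalSeq α S) {ε : ℝ} (hε : 0 < ε) :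
    ∃ (l : ℕ) (hl : 0 < l) (code : List B → List Bool), (FSC.block hl code).IsLossless ∧
      ∀ᶠ n : ℕ in atTop, (((FSC.block hl code).output (List.ofFn (pref S n))).length : ℝ) ≤
        n * (entropy α + ε) := by
  obtain ⟨l, D, hl, hD0, hJD, hlD⟩ :=
    exists_blockLength 1 (Fintype.card B) (ε := ε / 2) (by positivity)
  have hl0 : (0 : ℝ) < l := by exact_mod_cast hl
  obtain ⟨code, hne, hpre, hexp, -⟩ :=
    exists_prefix_code (prodMeasure_mem_stdSimplex hα l) (card_fun_le_two_pow l) hJD hD0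
  have : Nonempty B := ⟨S 0⟩
  -- Code words belong to functions on `Fin l`, whereas the compressor buffers lists; on lists of
  -- length `l` the inverse is genuine, and other lists never reach the code.
  have hinv : ∀ x : Fin l → B, Function.invFun List.ofFn (List.ofFn x) = x :=
    Function.leftInverse_invFun List.ofFn_injective
  have hsurj : ∀ w : List B, w.length = l → ∃ x : Fin l → B, List.ofFn x = w := by
    rintro w rfl; exact ⟨w.get, List.ofFn_get w⟩
  refine ⟨l, hl, fun w => code (Function.invFun List.ofFn w),
    FSC.block_isLossless hl _ (fun _ => hne _) ?_, ?_⟩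
  · intro x y s t hx hy hst
    obtain ⟨x, rfl⟩ := hsurj x hx
    obtain ⟨y, rfl⟩ := hsurj y hy
    simp only [hinv] at hst
    obtain ⟨hxy, hst⟩ := hpre x y s t hst
    exact ⟨congrArg List.ofFn hxy, hst⟩
  · have hlim : ∀ᶠ N : ℕ in atTop,
        ∑ x : Fin l → B, blockFreq S N x * ((code x).length : ℝ) < l * (entropy α + ε) := by
      refine (h.tendsto_sum hl fun x => ((code x).length : ℝ)).eventually_lt_const ?_
      rw [entropy_prodMeasure hα] at hexp
      have : 0 < ε / 2 * l := by positivity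
      linarith
    have hdiv : Tendsto (fun n : ℕ => n / l) atTop atTop := Nat.tendsto_div_const_atTop (by omega)
    filter_upwards [hdiv.eventually hlim, hdiv.eventually (eventually_gt_atTop 0)] with n hn hN
    -- The last `n % l` symbols stay in the buffer and produce no output.
    conv_lhs => rw [← Nat.div_add_mod' n l]
    rw [FSC.length_block_output hl _ S _ _ (Nat.mod_lt n hl), Nat.cast_sum]
    simp only [hinv]
    rw [show ∑ m ∈ Finset.range (n / l), ((code (seqBlock S l m)).length : ℝ) = _ from
      sum_seqBlock S hN fun x => ((code x).length : ℝ)]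
    have hle : ((n / l : ℕ) : ℝ) * l ≤ n := by exact_mod_cast Nat.div_mul_le_self n l
    have := entropy_nonneg hα
    calc ((n / l : ℕ) : ℝ) * ∑ x, blockFreq S (n / l) x * ((code x).length : ℝ)
        ≤ (n / l : ℕ) * (l * (entropy α + ε)) := by gcongr
      _ = ((n / l : ℕ) * l) * (entropy α + ε) := by ring
      _ ≤ n * (entropy α + ε) := by gcongr

end rates

/-! ### Optimal compression ratios -/

section ratio
variable {B : Type*}

/-- The least output length of a lossless compressor with `r` states on `u`, divided by `n * c`. -/
noncomputable def optRatio (c : ℝ) (r : ℕ) {n : ℕ} (u : Fin n → B) : ℝ :=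
  sInf {x : ℝ | ∃ (Q : Type) (_ : Fintype Q) (C : FSC B Q),
    Fintype.card Q = r ∧ C.IsLossless ∧ x = ((C.output (List.ofFn u)).length : ℝ) / (n * c)}

variable {c : ℝ}

theorem optRatio_nonneg (hc : 0 < c) (r : ℕ) {n : ℕ} (u : Fin n → B) : 0 ≤ optRatio c r u := by
  refine Real.sInf_nonneg ?_
  rintro _ ⟨Q, _, C, -, -, rfl⟩
  positivity

/-- States that are never reached can be added freely, so "exactly `t` states" is as good as "at
most `t`". -/
theorem optRatio_le (hc : 0 < c) {Q : Type*} [Fintype Q] {C : FSC B Q} (hC : C.IsLossless) {t : ℕ}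
    (ht : Fintype.card Q ≤ t) {n : ℕ} (u : Fin n → B) :
    optRatio c t u ≤ ((C.output (List.ofFn u)).length : ℝ) / (n * c) := by
  have : Nonempty Q := ⟨C.init⟩
  obtain ⟨e⟩ : Nonempty (Q ↪ Fin t) := Function.Embedding.nonempty_of_card_le (by simpa using ht)
  have he : Function.LeftInverse (Function.invFun e) e := Function.leftInverse_invFun e.injective
  refine csInf_le ⟨0, ?_⟩ ⟨Fin t, inferInstance, C.extend e (Function.invFun e), by simp,
    hC.extend he, by rw [C.extend_output he]⟩
  rintro _ ⟨Q, _, C, -, -, rfl⟩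
  positivity

/-- Coding symbol by symbol needs one state. This keeps the sets behind `optRatio` nonempty for `t ≥
1` and bounds all ratios uniformly. -/
theorem exists_lossless_card_one [Fintype B] [Nonempty B] :
    ∃ (_ : Fintype {w : List B // w.length < 1}) (C : FSC B {w : List B // w.length < 1}) (M : ℕ),
      Fintype.card {w : List B // w.length < 1} = 1 ∧ C.IsLossless ∧
      ∀ S : ℕ → B, ∀ n, (C.output (List.ofFn (pref S n))).length ≤ n * M := by
  classical
  obtain ⟨b⟩ := ‹Nonempty B›
  -- Any distribution would do: only the worst-case length is used.
  have hb : (Pi.single b 1 : B → ℝ) ∈ stdSimplex ℝ B := single_mem_stdSimplex ℝ b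
  obtain ⟨code, hne, hpre, -, hlen⟩ := exists_prefix_code hb (J := Fintype.card B)
    (D := Fintype.card B + 1) Nat.lt_two_pow_self.le Nat.lt_two_pow_self.le (by omega)
  have hL : Function.Injective (fun a : B => [a]) := fun a a' h => by simpa using h
  have : Nonempty B := ⟨b⟩
  have hinv : ∀ a, Function.invFun (fun a : B => [a]) [a] = a := Function.leftInverse_invFun hL
  let : Unique {w : List B // w.length < 1} :=
    { default := ⟨[], one_pos⟩
      uniq := fun w => Subtype.ext (List.length_eq_zero_iff.1 (Nat.lt_one_iff.1 w.2)) }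
  refine ⟨inferInstance, FSC.block one_pos fun w => code (Function.invFun (fun a => [a]) w),
    Fintype.card B + (Fintype.card B + 1), Fintype.card_unique,
    FSC.block_isLossless _ _ (fun _ => hne _) ?_, ?_⟩
  · intro x y s t hx hy hst
    obtain ⟨x, rfl⟩ := List.length_eq_one_iff.1 hx
    obtain ⟨y, rfl⟩ := List.length_eq_one_iff.1 hy
    simp only [hinv] at hst
    obtain ⟨hxy, hst⟩ := hpre x y s t hst
    exact ⟨congrArg (fun a => [a]) hxy, hst⟩
  · intro S n
    have := FSC.length_block_output one_pos
      (fun w => code (Function.invFun (fun a => [a]) w)) S n 0 one_pos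
    rw [mul_one, add_zero] at this
    rw [this]
    refine (Finset.sum_le_card_nsmul _ _ _ fun m _ => hlen _).trans (by simp)

theorem optRatio_set_nonempty [Fintype B] [Nonempty B] (c : ℝ) {t : ℕ} (ht : 1 ≤ t) {n : ℕ}
    (u : Fin n → B) :
    {x : ℝ | ∃ (Q : Type) (_ : Fintype Q) (C : FSC B Q), Fintype.card Q = t ∧ C.IsLossless ∧
      x = ((C.output (List.ofFn u)).length : ℝ) / (n * c)}.Nonempty := by
  obtain ⟨_, C, M, hQ, hC, -⟩ := exists_lossless_card_one (B := B)
  have : Nonempty {w : List B // w.length < 1} := ⟨C.init⟩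
  obtain ⟨e⟩ : Nonempty ({w : List B // w.length < 1} ↪ Fin t) :=
    Function.Embedding.nonempty_of_card_le (by simpa [hQ] using ht)
  have he : Function.LeftInverse (Function.invFun e) e := Function.leftInverse_invFun e.injective
  exact ⟨_, Fin t, inferInstance, C.extend e (Function.invFun e), by simp, hC.extend he, rfl⟩

theorem optRatio_anti [Fintype B] [Nonempty B] (hc : 0 < c) {s t : ℕ} (hs : 1 ≤ s) (hst : s ≤ t)
    {n : ℕ} (u : Fin n → B) : optRatio c t u ≤ optRatio c s u := by
  refine le_csInf (optRatio_set_nonempty c hs u) ?_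
  rintro _ ⟨Q, _, C, hQ, hC, rfl⟩
  exact optRatio_le hc hC (hQ.trans_le hst) u

theorem exists_optRatio_le [Fintype B] [Nonempty B] (hc : 0 < c) :
    ∃ M : ℝ, ∀ t, 1 ≤ t → ∀ (S : ℕ → B) n, optRatio c t (pref S n) ≤ M := by
  obtain ⟨_, C, M, hQ, hC, hM⟩ := exists_lossless_card_one (B := B)
  refine ⟨M / c, fun t ht S n => (optRatio_le hc hC (hQ.trans_le ht) _).trans ?_⟩
  rcases Nat.eq_zero_or_pos n with rfl | hn
  · simp; positivity
  · have hn' : (0 : ℝ) < n := by exact_mod_cast hn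
    rw [div_le_div_iff₀ (by positivity) hc]
    have : ((C.output (List.ofFn (pref S n))).length : ℝ) ≤ n * M := by exact_mod_cast hM S n
    calc _ ≤ (n * M : ℝ) * c := by gcongr
      _ = _ := by ring

/-- The optimal compression ratios of a normal sequence converge to the normalized entropy. -/
theorem IsNormalSeq.eventually_abs_optRatio_sub_le [Fintype B] {α : B → ℝ}
    (hα : α ∈ stdSimplex ℝ B) {S : ℕ → B} (h : IsNormalSeq α S) (hc : 0 < c) {ε : ℝ}
    (hε : 0 < ε) :
    ∃ t₀, 1 ≤ t₀ ∧ ∀ t, t₀ ≤ t → ∀ᶠ n : ℕ in atTop,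
      |optRatio c t (pref S n) - entropy α / c| ≤ ε := by
  have : Nonempty B := ⟨S 0⟩
  obtain ⟨l, hl, code, hC, hle⟩ := h.exists_block_length_le hα (ε := ε * c) (by positivity)
  have : Finite {w : List B // w.length < l} := (List.finite_length_lt B l).to_subtype
  have := Fintype.ofFinite {w : List B // w.length < l}
  -- The lower bound holds for every `t ≥ 1`; `t₀` only has to make room for the block compressor.
  refine ⟨max 1 (Fintype.card {w : List B // w.length < l}), le_max_left _ _, fun t ht => ?_⟩
  have ht1 : 1 ≤ t := (le_max_left _ _).trans ht
  filter_upwards [hle, h.eventually_le_length hα ht1 (ε := ε * c) (by positivity),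
    eventually_gt_atTop 0] with n hup hlow hn
  have hn' : (0 : ℝ) < n := by exact_mod_cast hn
  have hsplit : ∀ e : ℝ, (n * (entropy α + e * c)) / (n * c) = entropy α / c + e := by
    intro e; field_simp
  rw [abs_sub_le_iff]
  constructor
  · have := (optRatio_le hc hC ((le_max_right _ _).trans ht) (pref S n)).trans
      (div_le_div_of_nonneg_right hup (by positivity))
    rw [hsplit] at this
    linarith
  · have : entropy α / c + -ε ≤ optRatio c t (pref S n) := by
      refine le_csInf (optRatio_set_nonempty c ht1 _) ?_
      rintro _ ⟨Q, _, C, hQ, hC, rfl⟩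
      rw [← hsplit, neg_mul, ← sub_eq_add_neg]
      exact div_le_div_of_nonneg_right (hlow Q _ C hQ hC) (by positivity)
    linarith

end ratio

/-! ### Iterated limits -/

/-- A double sequence that is antitone and bounded in the inner variable and uniformly close to
`d` for large indices has the iterated limit `d`. -/
theorem hasIteratedLimit_of_antitone {f : ℕ → ℕ → ℝ} {d M : ℝ}
    (hanti : ∀ r, 1 ≤ r → ∀ s t, 1 ≤ s → s ≤ t → f r t ≤ f r s)
    (hbdd : ∀ r, 1 ≤ r → ∀ t, 1 ≤ t → M ≤ f r t)
    (hlim : ∀ ε > 0, ∃ r₀ t₀, ∀ r ≥ r₀, ∀ t ≥ t₀, |f r t - d| ≤ ε) :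
    HasIteratedLimit f d := by
  have hex : ∀ r, ∃ L, 1 ≤ r → Tendsto (fun t => f r t) atTop (𝓝 L) := by
    intro r
    by_cases hr : 1 ≤ r
    · refine ⟨⨅ t, f r (t + 1), fun _ => ?_⟩
      -- The index `t = 0` must be skipped: no compressor has an empty state set, so there the ratio
      -- is the infimum of the empty set, 0, and monotonicity may fail.
      rw [← tendsto_add_atTop_iff_nat 1]
      refine tendsto_atTop_ciInf (fun s t hst => hanti r hr _ _ (by omega) (by omega)) ⟨M, ?_⟩
      rintro _ ⟨t, rfl⟩
      exact hbdd r hr _ (by omega)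
    · exact ⟨0, fun h => absurd h hr⟩
  choose L hL using hex
  refine ⟨L, hL, Metric.tendsto_atTop.2 fun ε hε => ?_⟩
  obtain ⟨r₀, t₀, h⟩ := hlim (ε / 2) (by positivity)
  refine ⟨max 1 r₀, fun r hr => ?_⟩
  have h1 := ((hL r ((le_max_left _ _).trans hr)).sub_const d).abs
  have h2 : |L r - d| ≤ ε / 2 := le_of_tendsto h1
    ((eventually_ge_atTop t₀).mono fun t ht => h r ((le_max_right _ _).trans hr) t ht)
  rw [Real.dist_eq]
  linarith

theorem HasIteratedLimit.limUnder_eq {f : ℕ → ℕ → ℝ} {d : ℝ} (h : HasIteratedLimit f d) :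
    (limUnder atTop fun r : ℕ => limUnder atTop fun t : ℕ => f r t) = d := by
  obtain ⟨L, hL, hd⟩ := h
  refine Tendsto.limUnder_eq (hd.congr' ?_)
  filter_upwards [eventually_ge_atTop 1] with r hr
  exact (hL r hr).limUnder_eq.symm

/-! ### Mutual compression ratios and their iterated limits -/

section mutualRatio
variable {A : Type*} [Fintype A]

/-- The constant `c` of `optRatio` is independent of the alphabet because joint ratios over `A × A`
are still normalized by the logarithm of the size of `A`. -/
theorem mutualStateRatio_eq (r t : ℕ) {n : ℕ} (u w : Fin n → A) :
    mutualStateRatio r t u w =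
      optRatio (Real.logb 2 (Fintype.card A)) t u + optRatio (Real.logb 2 (Fintype.card A)) t w -
        optRatio (Real.logb 2 (Fintype.card A)) r (pairString u w) := rfl

theorem mutualStateRatio_anti (hA : 2 ≤ Fintype.card A) (r : ℕ) {s t : ℕ} (hs : 1 ≤ s)
    (hst : s ≤ t) {n : ℕ} (u w : Fin n → A) :
    mutualStateRatio r t u w ≤ mutualStateRatio r s u w := by
  have : Nonempty A := Fintype.card_pos_iff.1 (by omega)
  have hc : 0 < Real.logb 2 (Fintype.card A) := Real.logb_pos one_lt_two (by exact_mod_cast hA)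
  have h1 := optRatio_anti hc hs hst u
  have h2 := optRatio_anti hc hs hst w
  rw [mutualStateRatio_eq, mutualStateRatio_eq]
  linarith

theorem exists_abs_mutualStateRatio_le (hA : 2 ≤ Fintype.card A) (S T : ℕ → A) :
    ∃ M : ℝ, ∀ r, 1 ≤ r → ∀ t, 1 ≤ t → ∀ n,
      |mutualStateRatio r t (pref S n) (pref T n)| ≤ M := by
  have : Nonempty A := Fintype.card_pos_iff.1 (by omega)
  have hc : 0 < Real.logb 2 (Fintype.card A) := Real.logb_pos one_lt_two (by exact_mod_cast hA)
  obtain ⟨M, hM⟩ := exists_optRatio_le (B := A) hc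
  obtain ⟨M', hM'⟩ := exists_optRatio_le (B := A × A) hc
  refine ⟨2 * M + M', fun r hr t ht n => ?_⟩
  have h1 := hM t ht S n
  have h2 := hM t ht T n
  have h3 := hM' r hr (pairSeq S T) n
  have h4 := optRatio_nonneg hc t (pref S n)
  have h5 := optRatio_nonneg hc t (pref T n)
  have h6 := optRatio_nonneg hc r (pref (pairSeq S T) n)
  rw [mutualStateRatio_eq, abs_le]
  -- The string of pairs of two prefixes is, by definition, a prefix of the sequence of pairs.
  change _ ≤ _ - optRatio _ r (pref (pairSeq S T) n) ∧
    _ - optRatio _ r (pref (pairSeq S T) n) ≤ _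
  constructor <;> linarith

theorem eventually_abs_mutualStateRatio_sub_le (hA : 2 ≤ Fintype.card A) {α : A × A → ℝ}
    (hα : α ∈ stdSimplex ℝ (A × A)) {S T : ℕ → A} (h : IsNormalSeq α (pairSeq S T)) {ε : ℝ}
    (hε : 0 < ε) :
    ∃ r₀ t₀, 1 ≤ r₀ ∧ 1 ≤ t₀ ∧ ∀ r ≥ r₀, ∀ t ≥ t₀, ∀ᶠ n : ℕ in atTop,
      |mutualStateRatio r t (pref S n) (pref T n) -
        mutualInfo α / Real.logb 2 (Fintype.card A)| ≤ ε := by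
  have hc : 0 < Real.logb 2 (Fintype.card A) := Real.logb_pos one_lt_two (by exact_mod_cast hA)
  have hε3 : 0 < ε / 3 := by positivity
  obtain ⟨t₁, h1, H1⟩ :=
    h.fst.eventually_abs_optRatio_sub_le (marginalFst_mem_stdSimplex hα) hc hε3
  obtain ⟨t₂, h2, H2⟩ :=
    h.snd.eventually_abs_optRatio_sub_le (marginalSnd_mem_stdSimplex hα) hc hε3
  obtain ⟨r₀, h3, H3⟩ := h.eventually_abs_optRatio_sub_le hα hc hε3
  refine ⟨r₀, max t₁ t₂, h3, h1.trans (le_max_left _ _), fun r hr t ht => ?_⟩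
  filter_upwards [H1 t ((le_max_left _ _).trans ht), H2 t ((le_max_right _ _).trans ht), H3 r hr]
    with n e1 e2 e3
  rw [mutualStateRatio_eq, mutualInfo, sub_div, add_div]
  change |_ - optRatio _ r (pref (pairSeq S T) n) - _| ≤ _
  rw [abs_le] at e1 e2 e3 ⊢
  constructor <;> linarith

/-- The bound `M` makes the real-valued `liminf` and `limsup` meaningful. Both inherit monotonicity
in `t`, and both lie within `ε` of `d` as soon as the ratios eventually do. -/
theorem hasIteratedLimit_mutualRatio (hA : 2 ≤ Fintype.card A) {α : A × A → ℝ}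
    (hα : α ∈ stdSimplex ℝ (A × A)) {S T : ℕ → A} (h : IsNormalSeq α (pairSeq S T)) :
    HasIteratedLimit (lowerMutualRatio S T) (mutualInfo α / Real.logb 2 (Fintype.card A)) ∧
      HasIteratedLimit (upperMutualRatio S T)
        (mutualInfo α / Real.logb 2 (Fintype.card A)) := by
  obtain ⟨M, hM⟩ := exists_abs_mutualStateRatio_le hA S T
  set d := mutualInfo α / Real.logb 2 (Fintype.card A)
  set F : ℕ → ℕ → ℕ → ℝ := fun r t n => mutualStateRatio r t (pref S n) (pref T n)
  have hge : ∀ r, 1 ≤ r → ∀ t, 1 ≤ t → ∀ n, -M ≤ F r t n := fun r hr t ht n =>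
    (abs_le.1 (hM r hr t ht n)).1
  have hle : ∀ r, 1 ≤ r → ∀ t, 1 ≤ t → ∀ n, F r t n ≤ M := fun r hr t ht n =>
    (abs_le.1 (hM r hr t ht n)).2
  have ba : ∀ r, 1 ≤ r → ∀ t, 1 ≤ t → IsBoundedUnder (· ≤ ·) atTop (F r t) := fun r hr t ht =>
    isBoundedUnder_of ⟨M, hle r hr t ht⟩
  have bb : ∀ r, 1 ≤ r → ∀ t, 1 ≤ t → IsBoundedUnder (· ≥ ·) atTop (F r t) := fun r hr t ht =>
    isBoundedUnder_of ⟨-M, hge r hr t ht⟩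
  have hmono : ∀ r s t, 1 ≤ s → s ≤ t → F r t ≤ᶠ[atTop] F r s := fun r s t hs hst =>
    Eventually.of_forall fun n => mutualStateRatio_anti hA r hs hst _ _
  have hlow : ∀ r, 1 ≤ r → ∀ t, 1 ≤ t → -M ≤ liminf (F r t) atTop := fun r hr t ht =>
    le_liminf_of_le (ba r hr t ht).isCoboundedUnder_ge (Eventually.of_forall (hge r hr t ht))
  have hlu : ∀ r, 1 ≤ r → ∀ t, 1 ≤ t → liminf (F r t) atTop ≤ limsup (F r t) atTop :=
    fun r hr t ht => liminf_le_limsup (ba r hr t ht) (bb r hr t ht)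
  have hclose : ∀ ε > 0, ∃ r₀ t₀, ∀ r ≥ r₀, ∀ t ≥ t₀,
      |liminf (F r t) atTop - d| ≤ ε ∧ |limsup (F r t) atTop - d| ≤ ε := by
    intro ε hε
    obtain ⟨r₀, t₀, h1, h2, H⟩ := eventually_abs_mutualStateRatio_sub_le hA hα h hε
    refine ⟨r₀, t₀, fun r hr t ht => ?_⟩
    have hr1 := h1.trans hr
    have ht1 := h2.trans ht
    have e1 : d - ε ≤ liminf (F r t) atTop :=
      le_liminf_of_le (ba r hr1 t ht1).isCoboundedUnder_ge
        ((H r hr t ht).mono fun n hn => by linarith [(abs_le.1 hn).1])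
    have e2 : limsup (F r t) atTop ≤ d + ε :=
      limsup_le_of_le (bb r hr1 t ht1).isCoboundedUnder_le
        ((H r hr t ht).mono fun n hn => by linarith [(abs_le.1 hn).2])
    have e3 := hlu r hr1 t ht1
    constructor <;> rw [abs_le] <;> constructor <;> linarith
  constructor
  · refine hasIteratedLimit_of_antitone (M := -M) (fun r hr s t hs hst => ?_) hlow
      fun ε hε => ?_
    · exact liminf_le_liminf (hmono r s t hs hst) (bb r hr t (hs.trans hst))
        (ba r hr s hs).isCoboundedUnder_ge
    · obtain ⟨r₀, t₀, H⟩ := hclose ε hε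
      exact ⟨r₀, t₀, fun r hr t ht => (H r hr t ht).1⟩
  · refine hasIteratedLimit_of_antitone (M := -M) (fun r hr s t hs hst => ?_)
      (fun r hr t ht => (hlow r hr t ht).trans (hlu r hr t ht)) fun ε hε => ?_
    · exact limsup_le_limsup (hmono r s t hs hst) (bb r hr t (hs.trans hst)).isCoboundedUnder_le
        (ba r hr s hs)
    · obtain ⟨r₀, t₀, H⟩ := hclose ε hε
      exact ⟨r₀, t₀, fun r hr t ht => (H r hr t ht).2⟩

end mutualRatio

end FSMutual

theorem mainTheorem5 {A : Type*} [Fintype A] (hA : 2 ≤ Fintype.card A)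
    (α : A × A → ℝ) (hα : α ∈ stdSimplex ℝ (A × A)) (R₁ R₂ : ℕ → A)
    (hR : FSMutual.IsNormalSeq α (FSMutual.pairSeq R₁ R₂)) :
    FSMutual.HasIteratedLimit (FSMutual.lowerMutualRatio R₁ R₂)
        (FSMutual.mutualInfo α / Real.logb 2 (Fintype.card A)) ∧
      FSMutual.HasIteratedLimit (FSMutual.upperMutualRatio R₁ R₂)
        (FSMutual.mutualInfo α / Real.logb 2 (Fintype.card A)) ∧
      FSMutual.lowerMutualDim R₁ R₂ = FSMutual.upperMutualDim R₁ R₂ ∧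
      FSMutual.upperMutualDim R₁ R₂ =
        FSMutual.mutualInfo α / Real.logb 2 (Fintype.card A) := by
  obtain ⟨hl, hu⟩ := FSMutual.hasIteratedLimit_mutualRatio hA hα hR
  exact ⟨hl, hu, hl.limUnder_eq.trans hu.limUnder_eq.symm, hu.limUnder_eq⟩
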